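/- For a set $V$ of group words and a group $E$, let $V^*(E)$ denote the marginal subgroup of $E$, that is, the set of all $g\in E$ such that $v(f_1,\dots,f_{i-1},f_i g,f_{i+1},\dots,f_m)=v(f_1,\dots,f_m)$ for every word $v=v(x_1,\dots,x_m)\in V$, all $f_1,\dots,f_m\in E$ and all $1\le i\le m$. If $\mathfrak V$ is the variety of groups defined by the laws $V$, a group $G$ is called $\mathfrak V$-capable if $G\cong E/V^*(E)$ for some group $E$. Let $\mathfrak N_c$ be the variety of nilpotent groups of class at most $c$, and let $[\mathfrak N_{c_1},\mathfrak N_{c_2}]$ be the variety defined by the single law $$\bigl[[x_1,\dots,x_{c_1+1}],[y_1,\dots,y_{c_2+1}]\bigr]$$ (left-normed inner commutators in distinct variables $x_1,\dots,x_{c_1+1},y_1,\dots,y_{c_2+1}$). **Theorem 3.4.** Let $c_1,c_2$ be positive integers with $c_2<c_1\le 2c_2$ or $c_1=c_2>1$. Let $G\cong\mathbb Z_{n_1}\oplus\cdots\oplus\mathbb Z_{n_t}$ be a nontrivial finite abelian group, where $n_1,\dots,n_t$ are positive integers with $n_{i+1}\mid n_i$ for all $1\le i\le t-1$. Then $G$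 is $[\mathfrak N_{c_1},\mathfrak N_{c_2}]$-capable if and only if $t\ge 2$ and $n_1=n_2$. -/

import Mathlib

open scoped commutatorElement

/-- The marginal subgroup `V*(E)` of a group `E` with respect to a set `V` of words in the
variables `x₀, x₁, …`: the elements `g` of `E` such that multiplying any one argument of any word
of `V` on the right by `g` never changes the value of the word in `E`. The value of `v` at the
arguments `f : ℕ → E` is `FreeGroup.lift f v`. -/
def marginalSubgroup (V : Set (FreeGroup ℕ)) (E : Type*) [Group E] : Subgroup E where
  carrier := {g | ∀ v ∈ V, ∀ (f : ℕ → E) (i : ℕ),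
    FreeGroup.lift (Function.update f i (f i * g)) v = FreeGroup.lift f v}
  one_mem' := by
    intro v _ f i
    simp
  mul_mem' := by
    intro a b ha hb v hv f i
    have h := hb v hv (Function.update f i (f i * a)) i
    rw [ha v hv f i] at h
    simpa [mul_assoc] using h
  inv_mem' := by
    intro a ha v hv f i
    have h := ha v hv (Function.update f i (f i * a⁻¹)) i
    simpa using h.symm

instance marginalSubgroup_normal (V : Set (FreeGroup ℕ)) (E : Type*) [Group E] :
    (marginalSubgroup V E).Normal where
  conj_mem := by
    intro g hg h v hv f i
    have key : ∀ (p : ℕ → E), FreeGroup.lift (fun j => h⁻¹ * p j * h) v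
        = h⁻¹ * FreeGroup.lift p v * h := by
      intro p
      have e : FreeGroup.lift (fun j => h⁻¹ * p j * h)
          = (MulAut.conj h⁻¹).toMonoidHom.comp (FreeGroup.lift p) := by
        ext j
        simp
      rw [e]
      simp
    have h1 := hg v hv (fun j => h⁻¹ * f j * h) i
    have h2 : Function.update (fun j => h⁻¹ * f j * h) i (h⁻¹ * f i * h * g)
        = fun j => h⁻¹ * (Function.update f i (f i * (h * g * h⁻¹))) j * h := by
      ext j
      by_cases hj : j = i
      · subst hj
        simp [mul_assoc]
      · simp [hj]
    rw [h2, key, key] at h1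
    exact mul_left_cancel (mul_right_cancel h1)

/-- A group `G` is `𝔙`-capable, where `𝔙` is the variety defined by the set of laws `V`, if
`G ≅ E / V*(E)` for some group `E`. -/
def IsVarietalCapable.{u} (V : Set (FreeGroup ℕ)) (G : Type u) [Group G] : Prop :=
  ∃ (E : Type u) (_ : Group E), Nonempty (G ≃* E ⧸ marginalSubgroup V E)

/-- The left-normed commutator word `[x₀, x₁, …, x_c] = [[x₀, …, x_{c-1}], x_c]` of weight
`c + 1`. -/
def nilpotentWord : ℕ → FreeGroup ℕ
  | 0 => FreeGroup.of 0
  | c + 1 => ⁅nilpotentWord c, FreeGroup.of (c + 1)⁆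

/-- The law defining the variety `𝔑_c` of nilpotent groups of class at most `c`. -/
def nilpotentLaws (c : ℕ) : Set (FreeGroup ℕ) := {nilpotentWord c}

/-- The laws defining the variety `[𝔘, 𝔚]`: the commutators `[u, w]` of a law `u` of `𝔘` and a
law `w` of `𝔚` written in disjoint sets of variables (the even-numbered variables for `u`, the
odd-numbered ones for `w`). -/
def commutatorLaws (U W : Set (FreeGroup ℕ)) : Set (FreeGroup ℕ) :=
  {v | ∃ u ∈ U, ∃ w ∈ W,
    v = ⁅FreeGroup.map (fun k => 2 * k) u, FreeGroup.map (fun k => 2 * k + 1) w⁆}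

/-! Necessity. Suppose `E` modulo its marginal subgroup is abelian, so that every commutator is
marginal. A left-normed commutator of weight `c₁ + 2` is one of weight `c₁ + 1` with a commutator as
first argument, so `γ (c₁ + 1)` centralizes `γ c₂`, and symmetrically. Hence the commutators of `γ
c₁` with `γ c₂` are central, and the law is multiplicative in each argument. Let the quotient be
generated by `g` and elements of exponent `m`. In a value with an argument `g ^ m`, the exponent `m`
can be moved to any other argument and kills all but its `g`-part. The first two arguments of one
inner commutator then become powers of `g`, and the value is trivial. So `g ^ m` is marginal
(`pow_mem_marginalSubgroup_commutatorLaws`); with `g` over a generator of the largest cyclic factor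
and `m = n₂`, this gives `n₁ ∣ n₂`.

Sufficiency. In unitriangular matrices of size `c₁ + c₂ + 3` a value of the law lives in the top
right corner, where it is a Lie bracket of first superdiagonals. Over `R = ∏ ZMod (n i)`, restrict
the superdiagonals to a copy of `G` in which position `a` carries either `g` or a shifted `σ g`. The
corner then reads off the coefficient of one fixed word in two letters. A word with coefficient `±g
j` in a suitable bracket (`exists_word_lieSymbol_ne_zero`) shows that only elements over `0` are
marginal. The shift exists because each `n j` divides some `n (p j)` with `p j ≠ j`, which is where
`n₁ = n₂` enters. -/

/-! ### Left-normed commutators, marginal elements and the lower central series -/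

section Values

variable {E : Type*} [Group E]

/-- The left-normed commutator `[f 0, f 1, …, f c]`. -/
def leftNormedCommutator (f : ℕ → E) : ℕ → E
  | 0 => f 0
  | c + 1 => ⁅leftNormedCommutator f c, f (c + 1)⁆

theorem lift_nilpotentWord (f : ℕ → E) (c : ℕ) :
    FreeGroup.lift f (nilpotentWord c) = leftNormedCommutator f c := by
  induction c with
  | zero => simp [nilpotentWord, leftNormedCommutator]
  | succ c ih => simp [nilpotentWord, leftNormedCommutator, map_commutatorElement, ih]

theorem lift_map_nilpotentWord (f : ℕ → E) (φ : ℕ → ℕ) (c : ℕ) :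
    FreeGroup.lift f (FreeGroup.map φ (nilpotentWord c))
      = leftNormedCommutator (fun k => f (φ k)) c := by
  rw [← lift_nilpotentWord]
  have : (FreeGroup.lift f).comp (FreeGroup.map φ) = FreeGroup.lift fun k => f (φ k) := by
    ext k
    simp
  exact DFunLike.congr_fun this _

/-- Sequences of arguments correspond to pairs `(f, h)` by splitting indices by parity, so the two
inner commutators can be varied independently. -/
theorem mem_marginalSubgroup_commutatorLaws_iff {c₁ c₂ : ℕ} {g : E} :
    g ∈ marginalSubgroup (commutatorLaws (nilpotentLaws c₁) (nilpotentLaws c₂)) E ↔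
      (∀ (f h : ℕ → E) (i : ℕ),
        ⁅leftNormedCommutator (Function.update f i (f i * g)) c₁, leftNormedCommutator h c₂⁆
          = ⁅leftNormedCommutator f c₁, leftNormedCommutator h c₂⁆) ∧
      ∀ (f h : ℕ → E) (i : ℕ),
        ⁅leftNormedCommutator f c₁, leftNormedCommutator (Function.update h i (h i * g)) c₂⁆
          = ⁅leftNormedCommutator f c₁, leftNormedCommutator h c₂⁆ := by
  have key : ∀ p : ℕ → E, FreeGroup.lift p
      ⁅FreeGroup.map (fun k => 2 * k) (nilpotentWord c₁),
        FreeGroup.map (fun k => 2 * k + 1) (nilpotentWord c₂)⁆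
        = ⁅leftNormedCommutator (fun k => p (2 * k)) c₁,
            leftNormedCommutator (fun k => p (2 * k + 1)) c₂⁆ := fun p => by
    rw [map_commutatorElement, lift_map_nilpotentWord, lift_map_nilpotentWord]
  constructor
  · intro H
    have H' : ∀ (p : ℕ → E) (i : ℕ), _ = _ := fun p i => H _ ⟨_, rfl, _, rfl, rfl⟩ p i
    simp only [key] at H'
    refine ⟨fun f h i => ?_, fun f h i => ?_⟩
    · convert H' (fun n => if n % 2 = 0 then f (n / 2) else h (n / 2)) (2 * i) using 3
      · ext k
        rcases eq_or_ne k i with rfl | hk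
        · simp
        · simp [hk]
      · ext k
        rw [Function.update_of_ne (by omega), if_neg (by omega)]
        congr 1
        omega
      · ext k
        simp
      · ext k
        rw [if_neg (by omega)]
        congr 1
        omega
    · have hdiv : ∀ k, (2 * k + 1) / 2 = k := fun k => by omega
      have hmod : ∀ k, (2 * k + 1) % 2 = 1 := fun k => by omega
      convert H' (fun n => if n % 2 = 0 then f (n / 2) else h (n / 2)) (2 * i + 1) using 3
      · ext k
        rw [Function.update_of_ne (by omega)]
        simp
      · ext k
        rcases eq_or_ne k i with rfl | hk
        · simp [hdiv, hmod]
        · simp [hk, hdiv, hmod]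
      · ext k
        simp
      · ext k
        simp [hdiv, hmod]
  · rintro ⟨H₁, H₂⟩ v ⟨u, rfl, w, rfl, rfl⟩ p i
    rw [key, key]
    rcases Nat.even_or_odd' i with ⟨i, rfl | rfl⟩
    · convert H₁ (fun k => p (2 * k)) (fun k => p (2 * k + 1)) i using 3
      · ext k
        rcases eq_or_ne k i with rfl | hk
        · simp
        · simp [hk]
      · ext k
        rw [Function.update_of_ne (by omega)]
    · convert H₂ (fun k => p (2 * k)) (fun k => p (2 * k + 1)) i using 3
      · ext k
        rw [Function.update_of_ne (by omega)]
      · ext k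
        rcases eq_or_ne k i with rfl | hk
        · simp
        · simp [hk]

theorem mem_marginalSubgroup_commutatorLaws_comm {c₁ c₂ : ℕ} {g : E} :
    g ∈ marginalSubgroup (commutatorLaws (nilpotentLaws c₁) (nilpotentLaws c₂)) E ↔
      g ∈ marginalSubgroup (commutatorLaws (nilpotentLaws c₂) (nilpotentLaws c₁)) E := by
  rw [mem_marginalSubgroup_commutatorLaws_iff, mem_marginalSubgroup_commutatorLaws_iff, and_comm]
  refine and_congr ⟨fun H f h i => ?_, fun H f h i => ?_⟩ ⟨fun H f h i => ?_, fun H f h i => ?_⟩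
  all_goals
    rw [← inv_inj, commutatorElement_inv, commutatorElement_inv]
    exact H h f i

theorem leftNormedCommutator_congr {f f' : ℕ → E} {c : ℕ} (h : ∀ k ≤ c, f k = f' k) :
    leftNormedCommutator f c = leftNormedCommutator f' c := by
  induction c with
  | zero => exact h 0 le_rfl
  | succ c ih =>
    rw [leftNormedCommutator, leftNormedCommutator, ih fun k hk => h k (by omega), h _ le_rfl]

/-- Absorbing the innermost commutator into the first argument lets marginality of commutators act
on words of weight one higher. -/
theorem leftNormedCommutator_succ_eq (f : ℕ → E) (c : ℕ) :
    leftNormedCommutator f (c + 1)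
      = leftNormedCommutator (Function.update (fun k => f (k + 1)) 0 ⁅f 0, f 1⁆) c := by
  induction c with
  | zero => simp [leftNormedCommutator]
  | succ c ih =>
    rw [leftNormedCommutator, ih]
    simp [leftNormedCommutator]

theorem leftNormedCommutator_eq_one_of_zero (f : ℕ → E) (hf : f 0 = 1) (c : ℕ) :
    leftNormedCommutator f c = 1 := by
  induction c with
  | zero => exact hf
  | succ c ih => rw [leftNormedCommutator, ih, commutatorElement_one_left]

theorem leftNormedCommutator_eq_one_of_commute (f : ℕ → E) (hf : Commute (f 0) (f 1)) {c : ℕ}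
    (hc : 0 < c) : leftNormedCommutator f c = 1 := by
  obtain ⟨c, rfl⟩ := Nat.exists_eq_succ_of_ne_zero hc.ne'
  rw [leftNormedCommutator_succ_eq]
  apply leftNormedCommutator_eq_one_of_zero
  simpa using commutatorElement_eq_one_iff_commute.2 hf

theorem conj_leftNormedCommutator (f : ℕ → E) (z : E) (c : ℕ) :
    z * leftNormedCommutator f c * z⁻¹
      = leftNormedCommutator (fun k => z * f k * z⁻¹) c := by
  induction c with
  | zero => rfl
  | succ c ih =>
    rw [leftNormedCommutator, leftNormedCommutator, ← ih]
    simp only [commutatorElement_def]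
    group

/-- `γ c` is the term of the lower central series of `E` containing the commutators of weight
`c + 1`. -/
local notation "γ" => Subgroup.lowerCentralSeries (⊤ : Subgroup E)

theorem leftNormedCommutator_mem_lowerCentralSeries (f : ℕ → E) (c : ℕ) :
    leftNormedCommutator f c ∈ γ c := by
  induction c with
  | zero => simp
  | succ c ih => exact Subgroup.commutator_mem_commutator ih (Subgroup.mem_top _)

/-- Marginality only concerns values of left-normed words; this carries the resulting commutation
relations to whole terms of the series. Conjugation permutes these values, so their closure is
normal and the expansions of `⁅a * b, y⁆` and `⁅a⁻¹, y⁆` stay inside it. -/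
theorem lowerCentralSeries_eq_closure_leftNormedCommutator (c : ℕ) :
    γ c = Subgroup.closure (Set.range fun f : ℕ → E => leftNormedCommutator f c) := by
  have normal : ∀ c, (Subgroup.closure
      (Set.range fun f : ℕ → E => leftNormedCommutator f c)).Normal := fun c => by
    refine ⟨fun x hx z => ?_⟩
    induction hx using Subgroup.closure_induction with
    | mem x hx =>
      obtain ⟨f, rfl⟩ := hx
      exact Subgroup.subset_closure ⟨_, (conj_leftNormedCommutator f z c).symm⟩
    | one => simp
    | mul a b _ _ ha hb => simpa using mul_mem ha hb
    | inv a _ ha => simpa [mul_assoc] using inv_mem ha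
  apply le_antisymm
  · induction c with
    | zero =>
      intro x _
      exact Subgroup.subset_closure ⟨fun _ => x, rfl⟩
    | succ c ih =>
      have := normal (c + 1)
      rw [Subgroup.lowerCentralSeries_succ]
      refine (Subgroup.commutator_mono ih le_rfl).trans (Subgroup.commutator_le.2 ?_)
      intro x hx y _
      induction hx using Subgroup.closure_induction with
      | mem x hx =>
        obtain ⟨f, rfl⟩ := hx
        refine Subgroup.subset_closure ⟨Function.update f (c + 1) y, ?_⟩
        simp only [leftNormedCommutator, Function.update_self]
        congr 1
        apply leftNormedCommutator_congr
        intro k hk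
        rw [Function.update_of_ne (by omega)]
      | one => simp
      | mul a b _ _ ha hb =>
        have : ⁅a * b, y⁆ = a * ⁅b, y⁆ * a⁻¹ * ⁅a, y⁆ := by
          simp only [commutatorElement_def]; group
        rw [this]
        exact mul_mem ((normal (c + 1)).conj_mem _ hb _) ha
      | inv a _ ha =>
        have : ⁅a⁻¹, y⁆ = a⁻¹ * ⁅a, y⁆⁻¹ * a⁻¹⁻¹ := by
          simp only [commutatorElement_def]; group
        rw [this]
        exact (normal (c + 1)).conj_mem _ (inv_mem ha) _
  · rw [Subgroup.closure_le]
    rintro _ ⟨f, rfl⟩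
    exact leftNormedCommutator_mem_lowerCentralSeries f c

theorem commutatorElement_mem_lowerCentralSeries_succ {c : ℕ} {x : E} (hx : x ∈ γ c) (y : E) :
    ⁅x, y⁆ ∈ γ (c + 1) :=
  Subgroup.commutator_mem_commutator hx (Subgroup.mem_top y)

theorem commutatorElement_mul_mul_of_commute {x y z p : E} (hp : Commute p z)
    (hyx : Commute ⁅y, z⁆ x) (hyz : Commute ⁅y, z⁆ ⁅x, z⁆) :
    ⁅x * y * p, z⁆ = ⁅x, z⁆ * ⁅y, z⁆ := by
  have h1 : ⁅x * y * p, z⁆ = x * y * ⁅p, z⁆ * (x * y)⁻¹ * (x * ⁅y, z⁆ * x⁻¹) * ⁅x, z⁆ := by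
    simp only [commutatorElement_def]; group
  rw [h1, commutatorElement_eq_one_iff_commute.2 hp, ← hyx.eq, ← hyz.eq]
  group

theorem commutatorElement_mul_right_of_commute {x y z : E} (h : Commute ⁅z, y⁆ x) :
    ⁅z, x * y⁆ = ⁅z, x⁆ * ⁅z, y⁆ := by
  have h1 : ⁅z, x * y⁆ = ⁅z, x⁆ * (x * ⁅z, y⁆ * x⁻¹) := by
    simp only [commutatorElement_def]; group
  rw [h1, ← h.eq]
  group

theorem commute_mk_of_mem_lowerCentralSeries {c : ℕ} {x : E} (hx : x ∈ γ c) (y : E) :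
    Commute (QuotientGroup.mk' (γ (c + 1)) x) (QuotientGroup.mk' (γ (c + 1)) y) := by
  rw [← commutatorElement_eq_one_iff_commute, ← map_commutatorElement]
  exact (QuotientGroup.eq_one_iff _).2 (commutatorElement_mem_lowerCentralSeries_succ hx y)

/-- Modulo the next term of the lower central series, a left-normed commutator is multiplicative in
each of its arguments. -/
theorem leftNormedCommutator_update_mul (f : ℕ → E) {c i : ℕ} (hi : i ≤ c) (a b : E) :
    ∃ p ∈ γ (c + 1), leftNormedCommutator (Function.update f i (a * b)) c
      = leftNormedCommutator (Function.update f i a) c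
        * leftNormedCommutator (Function.update f i b) c * p := by
  induction c with
  | zero =>
    obtain rfl : i = 0 := by omega
    exact ⟨1, one_mem _, by simp [leftNormedCommutator]⟩
  | succ c ih =>
    have central : ∀ {x : E}, x ∈ γ c → ∀ y z : E, Commute
        ⁅QuotientGroup.mk' (γ (c + 1 + 1)) x, QuotientGroup.mk' (γ (c + 1 + 1)) y⁆
        (QuotientGroup.mk' (γ (c + 1 + 1)) z) := fun hx y z => by
      rw [← map_commutatorElement]
      exact commute_mk_of_mem_lowerCentralSeries
        (commutatorElement_mem_lowerCentralSeries_succ hx y) z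
    suffices QuotientGroup.mk' (γ (c + 1 + 1))
        (leftNormedCommutator (Function.update f i a) (c + 1)
          * leftNormedCommutator (Function.update f i b) (c + 1))
        = QuotientGroup.mk' (γ (c + 1 + 1))
          (leftNormedCommutator (Function.update f i (a * b)) (c + 1)) by
      exact ⟨_, QuotientGroup.eq.1 this, by group⟩
    rcases Nat.lt_or_ge c i with h | h
    · obtain rfl : i = c + 1 := by omega
      have hf : ∀ x, leftNormedCommutator (Function.update f (c + 1) x) (c + 1)
          = ⁅leftNormedCommutator f c, x⁆ := fun x => by
        rw [leftNormedCommutator, Function.update_self]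
        congr 1
        exact leftNormedCommutator_congr fun k hk => Function.update_of_ne (by omega) _ _
      simp only [hf, map_mul, map_commutatorElement]
      exact (commutatorElement_mul_right_of_commute
        (central (leftNormedCommutator_mem_lowerCentralSeries f c) b a)).symm
    · obtain ⟨p, hp, hab⟩ := ih h
      simp only [leftNormedCommutator, hab, map_mul, map_commutatorElement]
      rw [Function.update_of_ne (by omega), Function.update_of_ne (by omega),
        Function.update_of_ne (by omega)]
      have hb := central (leftNormedCommutator_mem_lowerCentralSeries (Function.update f i b) c)
        (f (c + 1))
      refine (commutatorElement_mul_mul_of_commute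
        (commute_mk_of_mem_lowerCentralSeries hp _) (hb _) ?_).symm
      rw [← map_commutatorElement _ (leftNormedCommutator (Function.update f i a) c)]
      exact hb _

/-- If a function of the sequence `f` is multiplicative in the arguments `0, …, c`, depends on them
only modulo `M` and vanishes when the first two commute, and the group is generated modulo `M` by
`g` and elements of exponent `m` modulo `M`, then it is unchanged by multiplying an argument by
`g ^ m`. -/
theorem update_mul_pow_eq_of_multiplicative {E' : Type*} [Group E'] {W : (ℕ → E) → E'} {c : ℕ}
    (hc : 0 < c) {M : Subgroup E}
    (hmul : ∀ i ≤ c, ∀ f a b, W (Function.update f i (a * b))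
      = W (Function.update f i a) * W (Function.update f i b))
    (hM : ∀ f i, ∀ x ∈ M, W (Function.update f i (f i * x)) = W f)
    (hcomm : ∀ f, Commute (f 0) (f 1) → W f = 1) {g : E} {m : ℕ}
    (hg : ∀ x, ∃ (k : ℕ) (h : E), x = g ^ k * h ∧ h ^ m ∈ M) {i : ℕ} (hi : i ≤ c) (f : ℕ → E) :
    W (Function.update f i (f i * g ^ m)) = W f := by
  have hone : ∀ j ≤ c, ∀ f, W (Function.update f j 1) = 1 := fun j hj f => by
    simpa using hmul j hj f 1 1
  have hpow : ∀ j ≤ c, ∀ f a (n : ℕ),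
      W (Function.update f j (a ^ n)) = W (Function.update f j a) ^ n := fun j hj f a n => by
    induction n with
    | zero => simpa using hone j hj f
    | succ n ih => rw [pow_succ, hmul j hj, ih, pow_succ]
  have reduce : ∀ j ≤ c, ∀ f, f i = g ^ m → ∃ k : ℕ, W f = W (Function.update f j (g ^ k)) ∧
      Function.update f j (g ^ k) i = g ^ m := fun j hj f hf => by
    rcases eq_or_ne i j with rfl | hij
    · exact ⟨m, by rw [← hf, Function.update_eq_self], by simp⟩
    · obtain ⟨k, h, hx, hh⟩ := hg (f j)
      refine ⟨k, ?_, by rw [Function.update_of_ne hij, hf]⟩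
      -- The exponent `m` moves from argument `i` to argument `j`, where `h ^ m` lies in `M`.
      have h1 : W (Function.update f j h) = 1 := by
        have h2 : Function.update f j h
            = Function.update (Function.update f j h) i (g ^ m) := by
          rw [← hf, eq_comm, Function.update_eq_self_iff, Function.update_of_ne hij]
        rw [h2, hpow i hi, Function.update_comm hij.symm, ← hpow j hj]
        have h3 := hM (Function.update (Function.update f i g) j 1) j _ hh
        rw [Function.update_self, one_mul, Function.update_idem, hone j hj] at h3
        exact h3
      conv_lhs => rw [← Function.update_eq_self j f, hx, hmul j hj, h1, mul_one]
  suffices W (Function.update f i (g ^ m)) = 1 by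
    rw [hmul i hi, Function.update_eq_self, this, mul_one]
  obtain ⟨k₀, e₀, h₀⟩ := reduce 0 (by omega) (Function.update f i (g ^ m)) (by simp)
  obtain ⟨k₁, e₁, -⟩ := reduce 1 (by omega) _ h₀
  rw [e₀, e₁, hcomm]
  rw [Function.update_self, Function.update_of_ne (by omega), Function.update_self]
  exact (Commute.refl g).pow_pow _ _

/-- On generators: the first argument `⁅f 0, f 1⁆` is marginal, so it may be replaced by `1`, which
makes the value trivial. -/
theorem commute_of_mem_lowerCentralSeries_succ {c₁ c₂ : ℕ}
    (hE : ∀ x y : E, ⁅x, y⁆ ∈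
      marginalSubgroup (commutatorLaws (nilpotentLaws c₁) (nilpotentLaws c₂)) E)
    {x y : E} (hx : x ∈ γ (c₁ + 1)) (hy : y ∈ γ c₂) :
    Commute x y := by
  have key : γ (c₁ + 1) ≤ Subgroup.centralizer (γ c₂ : Set E) := by
    rw [lowerCentralSeries_eq_closure_leftNormedCommutator (c₁ + 1),
      lowerCentralSeries_eq_closure_leftNormedCommutator c₂, Subgroup.centralizer_closure,
      Subgroup.closure_le]
    rintro _ ⟨f, rfl⟩
    rw [SetLike.mem_coe, Subgroup.mem_centralizer_iff]
    rintro _ ⟨h, rfl⟩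
    symm
    rw [← commutatorElement_eq_one_iff_mul_comm]
    have := (mem_marginalSubgroup_commutatorLaws_iff.1 (hE (f 0) (f 1))).1
      (Function.update (fun k => f (k + 1)) 0 1) h 0
    rw [leftNormedCommutator_eq_one_of_zero (Function.update _ 0 1) (by simp),
      commutatorElement_one_left, Function.update_self, one_mul, Function.update_idem] at this
    dsimp only
    rwa [leftNormedCommutator_succ_eq]
  exact (Subgroup.mem_centralizer_iff.1 (key hx) y hy).symm

/-- Conjugation by `z` multiplies `x` by `⁅x⁻¹, z⁆` and `y` by `⁅y⁻¹, z⁆`. These lie one step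
further down the series, so the former commutes with the conjugate of `y` and the latter with `x`;
neither changes the commutator. -/
theorem commute_commutatorElement_of_mem_lowerCentralSeries {c₁ c₂ : ℕ}
    (hE : ∀ x y : E, ⁅x, y⁆ ∈
      marginalSubgroup (commutatorLaws (nilpotentLaws c₁) (nilpotentLaws c₂)) E)
    {x y : E} (hx : x ∈ γ c₁) (hy : y ∈ γ c₂) (z : E) : Commute ⁅x, y⁆ z := by
  have hE' := fun x y => mem_marginalSubgroup_commutatorLaws_comm.1 (hE x y)
  have hp : Commute ⁅x⁻¹, z⁆ (z * y * z⁻¹) := commute_of_mem_lowerCentralSeries_succ hE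
    (commutatorElement_mem_lowerCentralSeries_succ (inv_mem hx) z)
    ((inferInstance : (γ c₂).Normal).conj_mem _ hy z)
  have hq : Commute ⁅y⁻¹, z⁆ x := commute_of_mem_lowerCentralSeries_succ hE'
    (commutatorElement_mem_lowerCentralSeries_succ (inv_mem hy) z) hx
  have h1 : z * ⁅x, y⁆ * z⁻¹ = x * (⁅x⁻¹, z⁆ * (z * y * z⁻¹) * ⁅x⁻¹, z⁆⁻¹) * x⁻¹
      * (z * y * z⁻¹)⁻¹ := by
    simp only [commutatorElement_def]; group
  have h2 : x * (z * y * z⁻¹) * x⁻¹ * (z * y * z⁻¹)⁻¹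
      = x * y * (⁅y⁻¹, z⁆ * x⁻¹ * ⁅y⁻¹, z⁆⁻¹) * y⁻¹ := by
    simp only [commutatorElement_def]; group
  rw [hp.eq, mul_inv_cancel_right, h2, hq.inv_right.eq, mul_inv_cancel_right,
    ← commutatorElement_def] at h1
  rw [commute_iff_eq, ← mul_inv_eq_iff_eq_mul.1 h1]

/-- If the quotient of `E` by its marginal subgroup is abelian, generated by `g` and elements of
exponent `m`, then `g ^ m` is marginal. -/
theorem pow_mem_marginalSubgroup_commutatorLaws {c₁ c₂ : ℕ} (hc₁ : 0 < c₁) (hc₂ : 0 < c₂)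
    (hE : ∀ x y : E, ⁅x, y⁆ ∈
      marginalSubgroup (commutatorLaws (nilpotentLaws c₁) (nilpotentLaws c₂)) E)
    {g : E} {m : ℕ} (hg : ∀ x, ∃ (k : ℕ) (h : E), x = g ^ k * h ∧ h ^ m ∈
      marginalSubgroup (commutatorLaws (nilpotentLaws c₁) (nilpotentLaws c₂)) E) :
    g ^ m ∈ marginalSubgroup (commutatorLaws (nilpotentLaws c₁) (nilpotentLaws c₂)) E := by
  have main : ∀ {c₁ c₂ : ℕ}, 0 < c₁ → (∀ x y : E, ⁅x, y⁆ ∈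
      marginalSubgroup (commutatorLaws (nilpotentLaws c₁) (nilpotentLaws c₂)) E) →
      (∀ x, ∃ (k : ℕ) (h : E), x = g ^ k * h ∧ h ^ m ∈
        marginalSubgroup (commutatorLaws (nilpotentLaws c₁) (nilpotentLaws c₂)) E) →
      ∀ (f h : ℕ → E) (i : ℕ),
        ⁅leftNormedCommutator (Function.update f i (f i * g ^ m)) c₁, leftNormedCommutator h c₂⁆
          = ⁅leftNormedCommutator f c₁, leftNormedCommutator h c₂⁆ := by
    intro c₁ c₂ hc₁ hE hg f h i
    rcases Nat.lt_or_ge c₁ i with hi | hi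
    · congr 1
      exact leftNormedCommutator_congr fun k hk => Function.update_of_ne (by omega) _ _
    have hh := leftNormedCommutator_mem_lowerCentralSeries h c₂
    refine update_mul_pow_eq_of_multiplicative
      (W := fun f => ⁅leftNormedCommutator f c₁, leftNormedCommutator h c₂⁆) hc₁ ?_
      (fun f i x hx => (mem_marginalSubgroup_commutatorLaws_iff.1 hx).1 f h i) ?_ hg hi f
    · intro i hi f a b
      obtain ⟨p, hp, hab⟩ := leftNormedCommutator_update_mul f hi a b
      have hb := commute_commutatorElement_of_mem_lowerCentralSeries hE
        (leftNormedCommutator_mem_lowerCentralSeries (Function.update f i b) c₁) hh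
      rw [hab]
      exact commutatorElement_mul_mul_of_commute
        (commute_of_mem_lowerCentralSeries_succ hE hp hh) (hb _) (hb _)
    · intro f hf
      rw [leftNormedCommutator_eq_one_of_commute f hf hc₁, commutatorElement_one_left]
  rw [mem_marginalSubgroup_commutatorLaws_iff]
  refine ⟨main hc₁ hE hg, fun f h i => ?_⟩
  rw [← inv_inj, commutatorElement_inv, commutatorElement_inv]
  refine main hc₂ (fun x y => mem_marginalSubgroup_commutatorLaws_comm.1 (hE x y))
    (fun x => ?_) h f i
  obtain ⟨k, y, hx, hy⟩ := hg x
  exact ⟨k, y, hx, mem_marginalSubgroup_commutatorLaws_comm.1 hy⟩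

end Values

/-! ### Unitriangular matrices: group commutators as Lie brackets of superdiagonals -/

section Unitriangular

variable {R : Type*} [CommRing R] {N : ℕ}

/-- The matrices whose entries below the `k`-th superdiagonal vanish. -/
def upperFiltration (R : Type*) [CommRing R] (N k : ℕ) :
    AddSubgroup (Matrix (Fin (N + 1)) (Fin (N + 1)) R) where
  carrier := {M | ∀ a b : Fin (N + 1), (b : ℕ) < a + k → M a b = 0}
  zero_mem' := fun _ _ _ => rfl
  add_mem' := fun hx hy a b h => by rw [Matrix.add_apply, hx a b h, hy a b h, add_zero]
  neg_mem' := fun hx a b h => by rw [Matrix.neg_apply, hx a b h, neg_zero]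

/-- The `k`-th superdiagonal of a matrix, extended by zero. -/
def superdiagonal (k : ℕ) :
    Matrix (Fin (N + 1)) (Fin (N + 1)) R →+ (ℕ → R) where
  toFun M a := if h : a + k ≤ N then M ⟨a, by omega⟩ ⟨a + k, by omega⟩ else 0
  map_zero' := by ext a; simp
  map_add' M M' := by
    ext a
    by_cases h : a + k ≤ N <;> simp [h]

theorem superdiagonal_apply (k : ℕ) (M : Matrix (Fin (N + 1)) (Fin (N + 1)) R) (a : ℕ) :
    superdiagonal k M a = if h : a + k ≤ N then M ⟨a, by omega⟩ ⟨a + k, by omega⟩ else 0 :=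
  rfl

theorem upperFiltration_antitone {k l : ℕ} (h : k ≤ l) :
    upperFiltration R N l ≤ upperFiltration R N k :=
  fun _ hM a b hab => hM a b (by omega)

theorem one_mem_upperFiltration_zero : (1 : Matrix (Fin (N + 1)) (Fin (N + 1)) R)
    ∈ upperFiltration R N 0 := by
  intro a b h
  apply Matrix.one_apply_ne
  rintro rfl
  omega

variable {k l : ℕ} {M M' : Matrix (Fin (N + 1)) (Fin (N + 1)) R}

theorem mul_mem_upperFiltration (hM : M ∈ upperFiltration R N k)
    (hM' : M' ∈ upperFiltration R N l) : M * M' ∈ upperFiltration R N (k + l) := by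
  intro a b h
  rw [Matrix.mul_apply]
  refine Finset.sum_eq_zero fun c _ => ?_
  rcases Nat.lt_or_ge c (a + k) with hc | hc
  · rw [hM a c hc, zero_mul]
  · rw [hM' c b (by omega), mul_zero]

theorem superdiagonal_mul (hM : M ∈ upperFiltration R N k)
    (hM' : M' ∈ upperFiltration R N l) (a : ℕ) :
    superdiagonal (k + l) (M * M') a = superdiagonal k M a * superdiagonal l M' (a + k) := by
  by_cases h : a + (k + l) ≤ N
  · rw [superdiagonal_apply, superdiagonal_apply, superdiagonal_apply, dif_pos h,
      dif_pos (by omega), dif_pos (by omega), Matrix.mul_apply,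
      Finset.sum_eq_single ⟨a + k, by omega⟩]
    · simp only [add_assoc]
    · intro c _ hc
      rcases Nat.lt_or_ge c (a + k) with hck | hck
      · rw [hM _ c hck, zero_mul]
      · rw [hM' c _ ?_, mul_zero]
        have : (c : ℕ) ≠ a + k := fun h => hc (Fin.ext h)
        change a + (k + l) < c + l
        omega
    · simp
  · rw [superdiagonal_apply, superdiagonal_apply l, dif_neg h, dif_neg (by omega), mul_zero]

theorem superdiagonal_eq_zero (hM : M ∈ upperFiltration R N (k + 1)) :
    superdiagonal k M = 0 := by
  ext a
  rw [superdiagonal_apply]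
  split_ifs with h
  · exact hM _ _ (by simp)
  · rfl

theorem eq_zero_of_mem_upperFiltration (hM : M ∈ upperFiltration R N N)
    (h : superdiagonal N M 0 = 0) : M = 0 := by
  ext a b
  rcases Nat.lt_or_ge b (a + N) with hab | hab
  · exact hM a b hab
  · have ha : a = ⟨0, by omega⟩ := Fin.ext (by change (a : ℕ) = 0; omega)
    have hb : b = ⟨0 + N, by omega⟩ := Fin.ext (by change (b : ℕ) = 0 + N; omega)
    rw [superdiagonal_apply, dif_pos (by omega)] at h
    rw [ha, hb, h, Matrix.zero_apply]

theorem pow_mem_upperFiltration (hM : M ∈ upperFiltration R N 1) (k : ℕ) :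
    M ^ k ∈ upperFiltration R N k := by
  induction k with
  | zero => simpa using one_mem_upperFiltration_zero
  | succ k ih =>
    rw [pow_succ]
    exact mul_mem_upperFiltration ih hM

/-- The unitriangular matrices whose first `k - 1` superdiagonals vanish. -/
def unitriangular (R : Type*) [CommRing R] (N k : ℕ) :
    Subgroup (Matrix (Fin (N + 1)) (Fin (N + 1)) R)ˣ where
  carrier := {g | (g : Matrix (Fin (N + 1)) (Fin (N + 1)) R) - 1 ∈ upperFiltration R N k ∧
    (↑g⁻¹ : Matrix (Fin (N + 1)) (Fin (N + 1)) R) - 1 ∈ upperFiltration R N k}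
  one_mem' := by simp [zero_mem]
  mul_mem' := by
    have key : ∀ x y : Matrix (Fin (N + 1)) (Fin (N + 1)) R, x - 1 ∈ upperFiltration R N k →
        y - 1 ∈ upperFiltration R N k → x * y - 1 ∈ upperFiltration R N k := by
      intro x y hx hy
      have : x * y - 1 = (x - 1) * (y - 1) + (x - 1) + (y - 1) := by noncomm_ring
      rw [this]
      exact add_mem (add_mem (upperFiltration_antitone (by omega)
        (mul_mem_upperFiltration hx hy)) hx) hy
    intro x y hx hy
    refine ⟨by simpa using key _ _ hx.1 hy.1, ?_⟩
    rw [mul_inv_rev, Units.val_mul]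
    exact key _ _ hy.2 hx.2
  inv_mem' := fun hx => ⟨hx.2, by simpa using hx.1⟩

theorem superdiagonal_mul_sub_one {g h : (Matrix (Fin (N + 1)) (Fin (N + 1)) R)ˣ}
    (hg : g ∈ unitriangular R N 1) (hh : h ∈ unitriangular R N 1) :
    superdiagonal 1 ((↑(g * h) : Matrix (Fin (N + 1)) (Fin (N + 1)) R) - 1)
      = superdiagonal 1 ((g : Matrix (Fin (N + 1)) (Fin (N + 1)) R) - 1)
        + superdiagonal 1 ((h : Matrix (Fin (N + 1)) (Fin (N + 1)) R) - 1) := by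
  have : (↑(g * h) : Matrix (Fin (N + 1)) (Fin (N + 1)) R) - 1
      = (g - 1) * (h - 1) + ((g - 1) + (h - 1)) := by
    rw [Units.val_mul]
    noncomm_ring
  rw [this, map_add, map_add, superdiagonal_eq_zero (mul_mem_upperFiltration hg.1 hh.1), zero_add]

/-- The left side is `(g * h - h * g) * (g⁻¹ * h⁻¹)`. The first summand is the Lie bracket of `g -
1` and `h - 1`; for unitriangular `g` and `h` the second is of higher order. -/
theorem commutatorElement_sub_one (g h : (Matrix (Fin (N + 1)) (Fin (N + 1)) R)ˣ) :
    (↑⁅g, h⁆ : Matrix (Fin (N + 1)) (Fin (N + 1)) R) - 1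
      = ((g - 1) * (h - 1) - (h - 1) * (g - 1))
        + ((g - 1) * (h - 1) - (h - 1) * (g - 1)) * (↑(g⁻¹ * h⁻¹) - 1) := by
  have h1 : ⁅g, h⁆.val = (g * h).val * (g⁻¹ * h⁻¹).val := by
    rw [← Units.val_mul, commutatorElement_def, mul_assoc (g * h)]
  have h2 : (1 : Matrix (Fin (N + 1)) (Fin (N + 1)) R) = (h * g).val * (g⁻¹ * h⁻¹).val := by
    rw [← Units.val_mul, ← mul_inv_rev, mul_inv_cancel, Units.val_one]
  conv_lhs => rw [h1]; arg 2; rw [h2]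
  rw [← sub_mul, Units.val_mul g, Units.val_mul h]
  noncomm_ring

theorem commutatorElement_mem_unitriangular {g h : (Matrix (Fin (N + 1)) (Fin (N + 1)) R)ˣ}
    (hk : 1 ≤ k) (hl : 1 ≤ l) (hg : g ∈ unitriangular R N k) (hh : h ∈ unitriangular R N l) :
    ⁅g, h⁆ ∈ unitriangular R N (k + l) ∧
      ∀ a, superdiagonal (k + l) ((↑⁅g, h⁆ : Matrix (Fin (N + 1)) (Fin (N + 1)) R) - 1) a
        = superdiagonal k ((g : Matrix (Fin (N + 1)) (Fin (N + 1)) R) - 1) a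
            * superdiagonal l ((h : Matrix (Fin (N + 1)) (Fin (N + 1)) R) - 1) (a + k)
          - superdiagonal l ((h : Matrix (Fin (N + 1)) (Fin (N + 1)) R) - 1) a
            * superdiagonal k ((g : Matrix (Fin (N + 1)) (Fin (N + 1)) R) - 1) (a + l) := by
  have mono : ∀ {j}, 1 ≤ j → unitriangular R N j ≤ unitriangular R N 1 := fun hj _ hx =>
    ⟨upperFiltration_antitone hj hx.1, upperFiltration_antitone hj hx.2⟩
  have aux : ∀ {k l : ℕ} {g h : (Matrix (Fin (N + 1)) (Fin (N + 1)) R)ˣ}, 1 ≤ k → 1 ≤ l →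
      g ∈ unitriangular R N k → h ∈ unitriangular R N l →
      ((g : Matrix (Fin (N + 1)) (Fin (N + 1)) R) - 1) * (h - 1) - (h - 1) * (g - 1)
        ∈ upperFiltration R N (k + l) ∧
      (((g : Matrix (Fin (N + 1)) (Fin (N + 1)) R) - 1) * (h - 1) - (h - 1) * (g - 1))
        * (↑(g⁻¹ * h⁻¹) - 1) ∈ upperFiltration R N (k + l + 1) := by
    intro k l g h hk hl hg hh
    have h1 : ((g : Matrix (Fin (N + 1)) (Fin (N + 1)) R) - 1) * (h - 1) - (h - 1) * (g - 1)
        ∈ upperFiltration R N (k + l) :=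
      sub_mem (mul_mem_upperFiltration hg.1 hh.1)
        (add_comm k l ▸ mul_mem_upperFiltration hh.1 hg.1)
    exact ⟨h1, mul_mem_upperFiltration h1
      (mul_mem (inv_mem (mono hk hg)) (inv_mem (mono hl hh))).1⟩
  have sub_mem : ∀ {k l : ℕ} {g h : (Matrix (Fin (N + 1)) (Fin (N + 1)) R)ˣ}, 1 ≤ k → 1 ≤ l →
      g ∈ unitriangular R N k → h ∈ unitriangular R N l →
      (↑⁅g, h⁆ : Matrix (Fin (N + 1)) (Fin (N + 1)) R) - 1 ∈ upperFiltration R N (k + l) := by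
    intro k l g h hk hl hg hh
    obtain ⟨h1, h2⟩ := aux hk hl hg hh
    rw [commutatorElement_sub_one]
    exact add_mem h1 (upperFiltration_antitone (by omega) h2)
  refine ⟨⟨sub_mem hk hl hg hh, ?_⟩, fun a => ?_⟩
  · rw [commutatorElement_inv, add_comm k l]
    exact sub_mem hl hk hh hg
  · rw [commutatorElement_sub_one, map_add, superdiagonal_eq_zero (aux hk hl hg hh).2, add_zero,
      map_sub, Pi.sub_apply, superdiagonal_mul hg.1 hh.1, add_comm k l,
      superdiagonal_mul hh.1 hg.1]

/-- The superdiagonal of the left-normed Lie commutator of matrices with superdiagonals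
`s 0, …, s c`. -/
def lieSymbol (s : ℕ → ℕ → R) : ℕ → ℕ → R
  | 0 => s 0
  | c + 1 => fun a => lieSymbol s c a * s (c + 1) (a + (c + 1)) - s (c + 1) a * lieSymbol s c (a + 1)

theorem leftNormedCommutator_mem_unitriangular
    {f : ℕ → (Matrix (Fin (N + 1)) (Fin (N + 1)) R)ˣ} (hf : ∀ i, f i ∈ unitriangular R N 1)
    (c : ℕ) : leftNormedCommutator f c ∈ unitriangular R N (c + 1) ∧
      superdiagonal (c + 1)
          ((leftNormedCommutator f c).val - 1)
        = lieSymbol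
          (fun i => superdiagonal 1 ((f i : Matrix (Fin (N + 1)) (Fin (N + 1)) R) - 1)) c := by
  induction c with
  | zero => exact ⟨hf 0, rfl⟩
  | succ c ih =>
    obtain ⟨h1, h2⟩ := commutatorElement_mem_unitriangular (by omega) le_rfl ih.1 (hf (c + 1))
    refine ⟨h1, funext fun a => ?_⟩
    rw [leftNormedCommutator, h2, ih.2, lieSymbol]

/-- Every sequence of length `N` is the first superdiagonal of a unitriangular matrix. -/
theorem exists_unitriangular_superdiagonal_eq (s : ℕ → R) (hs : ∀ a, N ≤ a → s a = 0) :
    ∃ u ∈ unitriangular R N 1,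
      superdiagonal 1 ((u : Matrix (Fin (N + 1)) (Fin (N + 1)) R) - 1) = s := by
  let B : Matrix (Fin (N + 1)) (Fin (N + 1)) R :=
    Matrix.of fun a b => if (b : ℕ) = a + 1 then s a else 0
  have hB : B ∈ upperFiltration R N 1 := fun a b h => by
    simp only [B, Matrix.of_apply]
    rw [if_neg (by omega)]
  have hB' : -B ∈ upperFiltration R N 1 := neg_mem hB
  -- The inverse of `1 + B` is a finite geometric series, since `B` is nilpotent.
  let C : Matrix (Fin (N + 1)) (Fin (N + 1)) R := ∑ k ∈ Finset.range (N + 1), (-B) ^ k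
  have hC : C ∈ upperFiltration R N 0 := sum_mem fun k _ =>
    upperFiltration_antitone (Nat.zero_le _) (pow_mem_upperFiltration hB' k)
  have hnil : (-B) ^ (N + 1) = 0 := by
    ext a b
    exact pow_mem_upperFiltration hB' (N + 1) a b (by omega)
  have h1 : (1 + B) * C = 1 := by
    have := mul_neg_geom_sum (-B) (N + 1)
    rwa [hnil, sub_neg_eq_add, sub_zero] at this
  have h2 : C * (1 + B) = 1 := by
    have := geom_sum_mul_neg (-B) (N + 1)
    rwa [hnil, sub_neg_eq_add, sub_zero] at this
  refine ⟨⟨1 + B, C, h1, h2⟩, ⟨?_, ?_⟩, ?_⟩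
  · simpa using hB
  · have : C - 1 = -B * C := by
      conv_lhs => rw [← h1]
      noncomm_ring
    simpa [this] using mul_mem_upperFiltration hB' hC
  · ext a
    rw [superdiagonal_apply]
    split_ifs with h
    · simp [B]
    · exact (hs a (by omega)).symm

end Unitriangular

/-! ### Capability from a nondegenerate bracket -/

section Capable

theorem map_mem_marginalSubgroup {E E' : Type*} [Group E] [Group E'] {V : Set (FreeGroup ℕ)}
    (φ : E →* E') (hφ : Function.Surjective φ) {x : E} (hx : x ∈ marginalSubgroup V E) :
    φ x ∈ marginalSubgroup V E' := by
  intro v hv f i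
  choose s hs using fun j => hφ (f j)
  have key : ∀ p : ℕ → E, φ (FreeGroup.lift p v) = FreeGroup.lift (fun j => φ (p j)) v := by
    intro p
    have : φ.comp (FreeGroup.lift p) = FreeGroup.lift fun j => φ (p j) := by
      ext j
      simp
    exact DFunLike.congr_fun this v
  have h := congrArg φ (hx v hv s i)
  rw [key, key] at h
  convert h using 2
  · congr 1
    ext j
    rcases eq_or_ne j i with rfl | hj
    · simp [hs]
    · simp [hs, hj]
  · congr 1
    ext j
    rw [hs]

theorem isVarietalCapable_of_surjective.{u} {V : Set (FreeGroup ℕ)} {E : Type} [Group E]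
    {G : Type u} [Group G] (φ : E →* G) (hφ : Function.Surjective φ)
    (hker : ∀ x, φ x = 1 ↔ x ∈ marginalSubgroup V E) : IsVarietalCapable V G := by
  let e : ULift.{u} E ≃* E := MulEquiv.ulift
  refine ⟨ULift.{u} E, inferInstance, ⟨?_⟩⟩
  refine ((QuotientGroup.quotientMulEquivOfEq ?_).trans
    (QuotientGroup.quotientKerEquivOfSurjective (φ.comp e.toMonoidHom)
      (hφ.comp e.surjective))).symm
  ext x
  rw [MonoidHom.mem_ker]
  refine Iff.trans ⟨fun h => ?_, fun h => ?_⟩ (hker (e x)).symm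
  · exact map_mem_marginalSubgroup e.toMonoidHom e.surjective h
  · simpa using map_mem_marginalSubgroup e.symm.toMonoidHom e.symm.surjective h

theorem map_leftNormedCommutator {E E' : Type*} [Group E] [Group E'] (φ : E →* E') (f : ℕ → E)
    (c : ℕ) : φ (leftNormedCommutator f c) = leftNormedCommutator (fun k => φ (f k)) c := by
  induction c with
  | zero => rfl
  | succ c ih => rw [leftNormedCommutator, leftNormedCommutator, map_commutatorElement, ih]

/-- The unitriangular matrices with superdiagonal in the image of `ψ`, as the graph of a
correspondence with the domain of `ψ`. -/
def superdiagonalFiber {R Γ : Type*} [CommRing R] [AddCommGroup Γ] (N : ℕ)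
    (ψ : Γ →+ (ℕ → R)) :
    Subgroup ((Matrix (Fin (N + 1)) (Fin (N + 1)) R)ˣ × Multiplicative Γ) where
  carrier := {p | p.1 ∈ unitriangular R N 1 ∧ superdiagonal 1 (p.1.val - 1) = ψ p.2.toAdd}
  one_mem' := ⟨one_mem _, by simp⟩
  mul_mem' := fun {x y} hx hy => ⟨mul_mem hx.1 hy.1, by
    rw [Prod.fst_mul, superdiagonal_mul_sub_one hx.1 hy.1, hx.2, hy.2, Prod.snd_mul, toAdd_mul,
      map_add]⟩
  inv_mem' := fun {x} hx => ⟨inv_mem hx.1, by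
    have h := superdiagonal_mul_sub_one hx.1 (inv_mem hx.1)
    rw [mul_inv_cancel, Units.val_one, sub_self, map_zero, hx.2] at h
    rw [Prod.fst_inv, Prod.snd_inv, toAdd_inv, map_neg]
    exact eq_neg_of_add_eq_zero_right h.symm⟩

/-- An abelian group is `[𝔑_{c₁}, 𝔑_{c₂}]`-capable if the `[[x, …], [y, …]]`-bracket on
superdiagonals of unitriangular matrices is nondegenerate on it. -/
theorem isVarietalCapable_of_lieSymbol_ne_zero.{u} {R Γ : Type} [CommRing R] [AddCommGroup Γ]
    {G : Type u} [Group G] (e : G ≃* Multiplicative Γ) (c₁ c₂ : ℕ) (ψ : Γ →+ (ℕ → R))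
    (hψ : ∀ g a, c₁ + 1 + (c₂ + 1) ≤ a → ψ g a = 0)
    (hnd : ∀ g, g ≠ 0 → ∃ f h : ℕ → Γ, f 0 = g ∧
      lieSymbol (fun k => ψ (f k)) c₁ 0 * lieSymbol (fun k => ψ (h k)) c₂ (c₁ + 1)
        - lieSymbol (fun k => ψ (h k)) c₂ 0 * lieSymbol (fun k => ψ (f k)) c₁ (c₂ + 1) ≠ 0) :
    IsVarietalCapable (commutatorLaws (nilpotentLaws c₁) (nilpotentLaws c₂)) G := by
  -- The size makes the weight of the law equal to the index of the last superdiagonal. The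
  -- coordinate in `Γ` provides the projection even when `ψ` is not injective.
  let E := superdiagonalFiber (c₁ + 1 + (c₂ + 1)) ψ
  let fstHom : E →* _ := (MonoidHom.fst _ _).comp E.subtype
  let sndHom : E →* Multiplicative Γ := (MonoidHom.snd _ _).comp E.subtype
  have hsnd : Function.Surjective sndHom := fun g => by
    obtain ⟨u, hu, h⟩ := exists_unitriangular_superdiagonal_eq _ (hψ g.toAdd)
    exact ⟨⟨(u, g), hu, h⟩, rfl⟩
  have value : ∀ F H : ℕ → E,
      fstHom ⁅leftNormedCommutator F c₁, leftNormedCommutator H c₂⁆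
        ∈ unitriangular R _ (c₁ + 1 + (c₂ + 1)) ∧
      superdiagonal (c₁ + 1 + (c₂ + 1))
        ((fstHom ⁅leftNormedCommutator F c₁, leftNormedCommutator H c₂⁆).val - 1) 0
      = lieSymbol (fun k => ψ (sndHom (F k)).toAdd) c₁ 0
          * lieSymbol (fun k => ψ (sndHom (H k)).toAdd) c₂ (c₁ + 1)
        - lieSymbol (fun k => ψ (sndHom (H k)).toAdd) c₂ 0
          * lieSymbol (fun k => ψ (sndHom (F k)).toAdd) c₁ (c₂ + 1) := fun F H => by
    have hF := leftNormedCommutator_mem_unitriangular (fun k => (F k).2.1) c₁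
    have hH := leftNormedCommutator_mem_unitriangular (fun k => (H k).2.1) c₂
    obtain ⟨h1, h2⟩ := commutatorElement_mem_unitriangular (by omega) (by omega) hF.1 hH.1
    rw [map_commutatorElement, map_leftNormedCommutator, map_leftNormedCommutator]
    refine ⟨h1, (h2 0).trans ?_⟩
    rw [hF.2, hH.2, zero_add, zero_add]
    simp only [(F _).2.2, (H _).2.2]
    rfl
  -- A value is determined by its corner entry, hence by the images of its arguments in `Γ`; so the
  -- kernel of `sndHom` is marginal.
  have ext_value : ∀ F H F' H' : ℕ → E, (∀ k, sndHom (F k) = sndHom (F' k)) →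
      (∀ k, sndHom (H k) = sndHom (H' k)) →
      ⁅leftNormedCommutator F c₁, leftNormedCommutator H c₂⁆
        = ⁅leftNormedCommutator F' c₁, leftNormedCommutator H' c₂⁆ := by
    intro F H F' H' hF hH
    obtain ⟨h1, h2⟩ := value F H
    obtain ⟨h1', h2'⟩ := value F' H'
    refine Subtype.ext (Prod.ext (Units.ext (sub_eq_zero.1 (eq_zero_of_mem_upperFiltration ?_ ?_)))
      ?_)
    · have h3 := sub_mem h1.1 h1'.1
      rw [sub_sub_sub_cancel_right] at h3
      exact h3
    · have h3 := h2.trans ((by simp only [hF, hH] : _ = _).trans h2'.symm)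
      rw [← sub_eq_zero, ← Pi.sub_apply, ← map_sub, sub_sub_sub_cancel_right] at h3
      exact h3
    · have h3 : ∀ x y : E, sndHom ⁅x, y⁆ = 1 := fun x y => by
        rw [map_commutatorElement, commutatorElement_eq_one_iff_mul_comm, mul_comm]
      exact (h3 _ _).trans (h3 _ _).symm
  refine isVarietalCapable_of_surjective (e.symm.toMonoidHom.comp sndHom)
    (e.symm.surjective.comp hsnd) fun x => ?_
  have hx : (e.symm.toMonoidHom.comp sndHom) x = 1 ↔ sndHom x = 1 := by simp
  rw [hx, mem_marginalSubgroup_commutatorLaws_iff]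
  constructor
  · intro h
    have hup : ∀ (f : ℕ → E) (i k : ℕ),
        sndHom (Function.update f i (f i * x) k) = sndHom (f k) := fun f i k => by
      rcases eq_or_ne k i with rfl | hk
      · rw [Function.update_self, map_mul, h, mul_one]
      · rw [Function.update_of_ne hk]
    exact ⟨fun f h i => ext_value _ _ _ _ (hup f i) fun _ => rfl,
      fun f h i => ext_value _ _ _ _ (fun _ => rfl) (hup h i)⟩
  · rintro ⟨h, -⟩
    by_contra hx
    obtain ⟨f, g, hf, hne⟩ := hnd (sndHom x).toAdd hx
    choose s hs using fun y => hsnd (Multiplicative.ofAdd y)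
    -- Changing the first argument from `1` to a marginal `x` keeps the value trivial, against the
    -- nonzero corner entry.
    have h1 := h (Function.update (fun k => s (f k)) 0 1) (fun k => s (g k)) 0
    rw [Function.update_self, one_mul, Function.update_idem,
      leftNormedCommutator_eq_one_of_zero (Function.update _ 0 1) (by simp),
      commutatorElement_one_left] at h1
    have h2 := (value (Function.update (fun k => s (f k)) 0 x) (fun k => s (g k))).2
    rw [h1, map_one, Units.val_one, sub_self, map_zero] at h2
    apply hne
    have h3 : ∀ k, (sndHom (Function.update (fun k => s (f k)) 0 x k)).toAdd = f k := fun k => by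
      rcases eq_or_ne k 0 with rfl | hk
      · rw [Function.update_self, hf]
      · rw [Function.update_of_ne hk, hs, toAdd_ofAdd]
    simp only [h3, hs, toAdd_ofAdd] at h2
    exact h2.symm

end Capable

/-! ### Word coefficients and products of cyclic groups -/

section AbelianGroups

theorem map_lieSymbol {R K : Type*} [CommRing R] [CommRing K] (π : R →+* K) (s : ℕ → ℕ → R)
    (c a : ℕ) : π (lieSymbol s c a) = lieSymbol (fun k b => π (s k b)) c a := by
  induction c generalizing a with
  | zero => rfl
  | succ c ih => simp only [lieSymbol, map_sub, map_mul, ih]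

theorem lieSymbol_succ {K : Type*} [CommRing K] (s : ℕ → ℕ → K) (c a : ℕ) :
    lieSymbol s (c + 1) a
      = lieSymbol s c a * s (c + 1) (a + (c + 1)) - s (c + 1) a * lieSymbol s c (a + 1) :=
  rfl

/-- Every monomial of the bracket fills each position of the window by a different argument, and
only argument `0` may be nonzero at `i` or `i'`; it cannot fill both. -/
theorem lieSymbol_eq_zero_of_lt {K : Type*} [CommRing K] {s : ℕ → ℕ → K} {c a i i' : ℕ}
    (hi : a ≤ i) (hii' : i < i') (hi' : i' ≤ a + c)
    (hs : ∀ k, 0 < k → k ≤ c → s k i = 0 ∧ s k i' = 0) : lieSymbol s c a = 0 := by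
  induction c generalizing a with
  | zero => omega
  | succ c ih =>
    have hs' : ∀ k, 0 < k → k ≤ c → s k i = 0 ∧ s k i' = 0 := fun k h h' => hs k h (by omega)
    have h1 : lieSymbol s c a * s (c + 1) (a + (c + 1)) = 0 := by
      rcases hi'.eq_or_lt with h | h
      · rw [← h, (hs (c + 1) (by omega) le_rfl).2, mul_zero]
      · rw [ih hi (by omega) hs', zero_mul]
    have h2 : s (c + 1) a * lieSymbol s c (a + 1) = 0 := by
      rcases hi.eq_or_lt with h | h
      · rw [h, (hs (c + 1) (by omega) le_rfl).1, zero_mul]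
      · rw [ih h (by omega) hs', mul_zero]
    rw [lieSymbol_succ, h1, h2, sub_zero]

/-- Only argument `0` can stand first, and the sole monomial starting with it is the product in the
given order, with coefficient `1`. -/
theorem lieSymbol_eq_of_eq_one {K : Type*} [CommRing K] {s : ℕ → ℕ → K} {c a : ℕ}
    (hs : ∀ k, 0 < k → k ≤ c → s k a = 0 ∧ s k (a + k) = 1) : lieSymbol s c a = s 0 a := by
  induction c with
  | zero => rfl
  | succ c ih =>
    rw [lieSymbol_succ, ih fun k h h' => hs k h (by omega), (hs (c + 1) (by omega) le_rfl).1,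
      (hs (c + 1) (by omega) le_rfl).2]
    ring

/-- There is a word in two letters (`X` is the set of positions of the first letter) which occurs
with coefficient `±γ` in the bracket `[[g, y, …, y], [z₀, z₁, …]]`, where `z k` is `x` or `y`. -/
theorem exists_word_lieSymbol_ne_zero {c₁ c₂ : ℕ} (hc : c₂ < c₁ ∨ c₁ = c₂ ∧ 1 < c₂) :
    ∃ (X : Set ℕ) (T : ℕ → Bool), ∀ {K : Type} [CommRing K] (x y g : ℕ → K) (γ : K),
      (∀ a < c₁ + 1 + (c₂ + 1), a ∈ X → x a = 1 ∧ y a = 0 ∧ g a = γ) →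
      (∀ a < c₁ + 1 + (c₂ + 1), a ∉ X → x a = 0 ∧ y a = 1) → γ ≠ 0 →
      lieSymbol (fun k => if k = 0 then g else y) c₁ 0
          * lieSymbol (fun k => if T k then x else y) c₂ (c₁ + 1)
        - lieSymbol (fun k => if T k then x else y) c₂ 0
          * lieSymbol (fun k => if k = 0 then g else y) c₁ (c₂ + 1) ≠ 0 := by
  rcases hc with hc | ⟨rfl, hc⟩
  -- The word is `x y^c₂ x y^c₁`, and the second inner commutator is `[x, y, …, y]`. As `c₂ < c₁`,
  -- the first `c₁ + 1` letters contain two `x`, so only one of the two products survives.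
  · refine ⟨{0, c₂ + 1}, fun k => decide (k = 0), fun {K} _ x y g γ hX hX' hγ => ?_⟩
    have mem₀ : 0 ∈ ({0, c₂ + 1} : Set ℕ) := by simp
    have mem₁ : c₂ + 1 ∈ ({0, c₂ + 1} : Set ℕ) := by simp
    have h1 : lieSymbol (fun k => if k = 0 then g else y) c₁ 0 = 0 := by
      refine lieSymbol_eq_zero_of_lt (i := 0) (i' := c₂ + 1) le_rfl (by omega) (by omega)
        fun k hk _ => ?_
      rw [if_neg hk.ne']
      exact ⟨(hX 0 (by omega) mem₀).2.1, (hX _ (by omega) mem₁).2.1⟩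
    have h2 : lieSymbol (fun k => if decide (k = 0) then x else y) c₂ 0 = 1 := by
      rw [lieSymbol_eq_of_eq_one, if_pos (by simp), (hX 0 (by omega) mem₀).1]
      intro k hk hk'
      rw [if_neg (by simpa using hk.ne')]
      exact ⟨(hX 0 (by omega) mem₀).2.1, (hX' _ (by omega) (by simp; omega)).2⟩
    have h3 : lieSymbol (fun k => if k = 0 then g else y) c₁ (c₂ + 1) = γ := by
      rw [lieSymbol_eq_of_eq_one, if_pos rfl, (hX _ (by omega) mem₁).2.2]
      intro k hk hk'
      rw [if_neg hk.ne']
      exact ⟨(hX _ (by omega) mem₁).2.1, (hX' _ (by omega) (by simp; omega)).2⟩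
    rw [h1, h2, h3]
    simpa using hγ
  · obtain ⟨d, rfl⟩ : ∃ d, c₁ = d + 1 := ⟨c₁ - 1, by omega⟩
    -- For equal weights the previous choice would give two cancelling products. Here the word is `x
    -- x y^d x y^(d+1)` and the second inner commutator is `[x, y, …, y, x]`, in which `x x y^d` has
    -- coefficient `-1`; this needs `d ≥ 1`.
    refine ⟨{0, 1, d + 2}, fun k => decide (k = 0 ∨ k = d + 1), fun {K} _ x y g γ hX hX' hγ => ?_⟩
    have mem₀ : 0 ∈ ({0, 1, d + 2} : Set ℕ) := by simp
    have mem₁ : 1 ∈ ({0, 1, d + 2} : Set ℕ) := by simp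
    have mem₂ : d + 1 + 1 ∈ ({0, 1, d + 2} : Set ℕ) := by simp
    have h1 : lieSymbol (fun k => if k = 0 then g else y) (d + 1) 0 = 0 := by
      refine lieSymbol_eq_zero_of_lt (i := 0) (i' := 1) le_rfl (by omega) (by omega)
        fun k hk _ => ?_
      rw [if_neg hk.ne']
      exact ⟨(hX 0 (by omega) mem₀).2.1, (hX _ (by omega) mem₁).2.1⟩
    have h2 : lieSymbol (fun k => if decide (k = 0 ∨ k = d + 1) then x else y) (d + 1) 0
        = -1 := by
      rw [lieSymbol_succ, zero_add, if_pos (by simp), (hX' _ (by omega) (by simp; omega)).1,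
        (hX 0 (by omega) mem₀).1, zero_add, lieSymbol_eq_of_eq_one (a := 1), if_pos (by simp),
        (hX 1 (by omega) mem₁).1]
      · ring
      · intro k hk hk'
        rw [if_neg (by simp; omega)]
        exact ⟨(hX 1 (by omega) mem₁).2.1, (hX' _ (by omega) (by simp; omega)).2⟩
    have h3 : lieSymbol (fun k => if k = 0 then g else y) (d + 1) (d + 1 + 1) = γ := by
      rw [lieSymbol_eq_of_eq_one, if_pos rfl, (hX _ (by omega) mem₂).2.2]
      intro k hk hk'
      rw [if_neg hk.ne']
      exact ⟨(hX _ (by omega) mem₂).2.1, (hX' _ (by omega) (by simp; omega)).2⟩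
    rw [h1, h2, h3]
    simpa using hγ

open Classical in
-- Nondegeneracy is tested at a coordinate `j` with `g j ≠ 0`. There the unit vectors at `j` and `p
-- j` act as the letters `x` and `y`: the positions in `X` read coordinate `j`, the others
-- coordinate `p j` reduced modulo `n j`.
theorem isVarietalCapable_pi_zmod.{u} {c₁ c₂ : ℕ} (hc : c₂ < c₁ ∨ c₁ = c₂ ∧ 1 < c₂)
    {ι : Type} {n : ι → ℕ} {p : ι → ι} (hpne : ∀ j, p j ≠ j) (hp : ∀ j, n j ∣ n (p j))
    {G : Type u} [Group G] (e : G ≃* Multiplicative (∀ i, ZMod (n i))) :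
    IsVarietalCapable (commutatorLaws (nilpotentLaws c₁) (nilpotentLaws c₂)) G := by
  obtain ⟨X, T, hXT⟩ := exists_word_lieSymbol_ne_zero hc
  let σ : (∀ i, ZMod (n i)) →+* (∀ i, ZMod (n i)) :=
    RingHom.pi fun j => (ZMod.castHom (hp j) (ZMod (n j))).comp (Pi.evalRingHom _ (p j))
  let ψ : (∀ i, ZMod (n i)) →+ (ℕ → ∀ i, ZMod (n i)) :=
    { toFun := fun g a => if a < c₁ + 1 + (c₂ + 1) then (if a ∈ X then g else σ g) else 0
      map_zero' := by ext a; simp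
      map_add' := fun g h => by
        ext a : 1
        simp only [Pi.add_apply]
        split_ifs <;> simp }
  have hψ : ∀ g a, ψ g a = if a < c₁ + 1 + (c₂ + 1) then (if a ∈ X then g else σ g) else 0 :=
    fun _ _ => rfl
  refine isVarietalCapable_of_lieSymbol_ne_zero e c₁ c₂ ψ
    (fun g a ha => by rw [hψ, if_neg (by omega)]) fun g hg => ?_
  obtain ⟨j, hj⟩ := Function.ne_iff.1 hg
  let x : ∀ i, ZMod (n i) := Pi.single j 1
  let y : ∀ i, ZMod (n i) := Pi.single (p j) 1
  have hσx : σ x j = 0 := by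
    change ZMod.castHom (hp j) (ZMod (n j)) (x (p j)) = 0
    rw [show x (p j) = 0 from Pi.single_eq_of_ne (hpne j) 1, map_zero]
  have hσy : σ y j = 1 := by
    change ZMod.castHom (hp j) (ZMod (n j)) (y (p j)) = 1
    rw [show y (p j) = 1 from Pi.single_eq_same _ _, map_one]
  have hx : x j = 1 := Pi.single_eq_same _ _
  have hy : y j = 0 := Pi.single_eq_of_ne (hpne j).symm 1
  refine ⟨fun k => if k = 0 then g else y, fun k => if T k then x else y, if_pos rfl, ?_⟩
  have key := hXT (fun a => ψ x a j) (fun a => ψ y a j) (fun a => ψ g a j) (g j)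
    (fun a ha haX => by simp only [hψ, if_pos ha, if_pos haX, hx, hy, and_self])
    (fun a ha haX => by simp only [hψ, if_pos ha, if_neg haX, hσx, hσy, and_self]) hj
  intro h
  apply key
  have h' := congrArg (Pi.evalRingHom (fun i => ZMod (n i)) j) h
  rw [map_sub, map_mul, map_mul, map_zero, map_lieSymbol, map_lieSymbol, map_lieSymbol,
    map_lieSymbol] at h'
  have aux₁ : (fun (k b : ℕ) => Pi.evalRingHom (fun i => ZMod (n i)) j
      (ψ (if k = 0 then g else y) b))
      = fun k => if k = 0 then (fun a => ψ g a j) else fun a => ψ y a j := by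
    ext k b : 2
    split_ifs <;> rfl
  have aux₂ : (fun (k b : ℕ) => Pi.evalRingHom (fun i => ZMod (n i)) j
      (ψ (if T k then x else y) b))
      = fun k => if T k then (fun a => ψ x a j) else fun a => ψ y a j := by
    ext k b : 2
    split_ifs <;> rfl
  rwa [aux₁, aux₂] at h'

/-- If `∏ ZMod (n i)` is `[𝔑_{c₁}, 𝔑_{c₂}]`-capable, then a common period of all factors but one
is a period of the remaining factor. -/
theorem dvd_of_isVarietalCapable {c₁ c₂ : ℕ} (hc₁ : 0 < c₁) (hc₂ : 0 < c₂) {ι : Type*}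
    {n : ι → ℕ} {i₀ : ι} (hpos : 0 < n i₀) {m : ℕ} (hm : ∀ i, i ≠ i₀ → n i ∣ m)
    {G : Type*} [Group G] (e : G ≃* Multiplicative (∀ i, ZMod (n i)))
    (hG : IsVarietalCapable (commutatorLaws (nilpotentLaws c₁) (nilpotentLaws c₂)) G) :
    n i₀ ∣ m := by
  classical
  obtain ⟨E, _, ⟨φ⟩⟩ := hG
  let θ : E →* Multiplicative (∀ i, ZMod (n i)) :=
    (φ.symm.trans e).toMonoidHom.comp (QuotientGroup.mk' _)
  have hθ : Function.Surjective θ :=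
    (φ.symm.trans e).surjective.comp (QuotientGroup.mk'_surjective _)
  have hker : ∀ x, x ∈ marginalSubgroup (commutatorLaws (nilpotentLaws c₁) (nilpotentLaws c₂)) E
      ↔ θ x = 1 := fun x => by
    refine (QuotientGroup.eq_one_iff x).symm.trans ?_
    exact (MulEquiv.map_eq_one_iff (φ.symm.trans e)).symm
  obtain ⟨g, hg⟩ := hθ (Multiplicative.ofAdd (Pi.single i₀ 1))
  have : NeZero (n i₀) := ⟨hpos.ne'⟩
  have h := pow_mem_marginalSubgroup_commutatorLaws (E := E) (c₁ := c₁) (c₂ := c₂) hc₁ hc₂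
    (fun x y => by
      rw [hker, map_commutatorElement, commutatorElement_eq_one_iff_mul_comm, mul_comm])
    (g := g) (m := m) fun x => by
      -- Dividing out the power of `g` given by coordinate `i₀` leaves an element supported on the
      -- other factors, which `m` annihilates.
      refine ⟨((θ x).toAdd i₀).val, (g ^ ((θ x).toAdd i₀).val)⁻¹ * x, by group, ?_⟩
      rw [hker]
      apply Multiplicative.toAdd.injective
      rw [map_pow θ, map_mul θ, map_inv θ, map_pow θ, hg, toAdd_pow, toAdd_mul, toAdd_inv, toAdd_pow,
        toAdd_ofAdd, toAdd_one]
      ext i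
      change m • (-(((θ x).toAdd i₀).val • (Pi.single i₀ 1 : ∀ i, ZMod (n i)) i)
        + (θ x).toAdd i) = 0
      rcases eq_or_ne i i₀ with rfl | hi
      · rw [Pi.single_eq_same, nsmul_eq_mul _ (1 : ZMod (n i)), ZMod.natCast_zmod_val, mul_one,
          neg_add_cancel, smul_zero]
      · rw [Pi.single_eq_of_ne hi, smul_zero, neg_zero, zero_add, nsmul_eq_mul,
          (ZMod.natCast_eq_zero_iff _ _).2 (hm i hi), zero_mul]
  rw [hker, map_pow, hg] at h
  have h' := congrFun (congrArg Multiplicative.toAdd h) i₀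
  rw [toAdd_pow, toAdd_ofAdd, toAdd_one, Pi.smul_apply, Pi.single_eq_same, Pi.zero_apply,
    nsmul_eq_mul, mul_one] at h'
  exact (ZMod.natCast_eq_zero_iff _ _).1 h'

end AbelianGroups

/-! ### The characterization of capable finite abelian groups -/

theorem theorem3p4 (c₁ c₂ : ℕ) (hc : (c₂ < c₁ ∧ c₁ ≤ 2 * c₂) ∨ (c₁ = c₂ ∧ 1 < c₂))
    (t : ℕ) (n : Fin t → ℕ) (hpos : ∀ i, 0 < n i)
    (hdvd : ∀ (i : ℕ) (hi : i + 1 < t), n ⟨i + 1, hi⟩ ∣ n ⟨i, Nat.lt_of_succ_lt hi⟩)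
    (G : Type*) [Group G] [Nontrivial G]
    (hG : Nonempty (G ≃* Multiplicative (∀ i : Fin t, ZMod (n i)))) :
    IsVarietalCapable (commutatorLaws (nilpotentLaws c₁) (nilpotentLaws c₂)) G ↔
      ∃ ht : 2 ≤ t, n ⟨0, Nat.lt_of_lt_of_le Nat.zero_lt_two ht⟩
        = n ⟨1, Nat.lt_of_lt_of_le Nat.one_lt_two ht⟩ := by
  obtain ⟨e⟩ := hG
  have hdvd' : ∀ (i k : ℕ) (hk : i + k < t), n ⟨i + k, hk⟩ ∣ n ⟨i, by omega⟩ := by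
    intro i k
    induction k with
    | zero => exact fun _ => dvd_rfl
    | succ k ih => exact fun hk => (hdvd (i + k) hk).trans (ih (by omega))
  have ht0 : 0 < t := by
    by_contra h
    obtain rfl : t = 0 := by omega
    exact not_subsingleton G e.toEquiv.subsingleton
  constructor
  · intro h
    have hdiv : ∀ m, (∀ i : Fin t, i ≠ ⟨0, ht0⟩ → n i ∣ m) → n ⟨0, ht0⟩ ∣ m := fun m hm =>
      dvd_of_isVarietalCapable (by omega) (by omega) (hpos _) hm e h
    by_cases ht : 2 ≤ t
    · refine ⟨ht, Nat.dvd_antisymm (hdiv _ fun i hi => ?_) (hdvd 0 ht)⟩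
      have hi0 : (i : ℕ) ≠ 0 := fun h => hi (Fin.ext h)
      have hi1 := i.isLt
      have := hdvd' 1 (i - 1) (by omega)
      rwa [show (⟨1 + (i - 1), by omega⟩ : Fin t) = i from
        Fin.ext (by change 1 + ((i : ℕ) - 1) = i; omega)] at this
    · obtain rfl : t = 1 := by omega
      -- With a single factor, `m = 1` is allowed, which would make the group trivial.
      have h1 : n 0 = 1 := Nat.dvd_one.1 (hdiv 1 fun i hi => (hi (Subsingleton.elim _ _)).elim)
      have : Subsingleton (∀ i : Fin 1, ZMod (n i)) := by
        refine ⟨fun x y => funext fun i => ?_⟩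
        obtain rfl : i = 0 := Subsingleton.elim _ _
        have : Subsingleton (ZMod (n 0)) := by rw [h1]; infer_instance
        exact Subsingleton.elim _ _
      exact (not_subsingleton G
        (e.toEquiv.trans Multiplicative.toAdd).subsingleton).elim
  · rintro ⟨ht, h01⟩
    -- Index `0` is paired with `1`, where divisibility is the equality `h01`; every other index is
    -- paired with `0`, whose modulus all others divide.
    refine isVarietalCapable_pi_zmod (by omega)
      (p := fun j : Fin t => if (j : ℕ) = 0 then ⟨1, ht⟩ else ⟨0, ht0⟩)
      (fun j hj => ?_) (fun j => ?_) e
    · have := congrArg Fin.val hj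
      split_ifs at this <;> simp at this <;> omega
    · split_ifs with h
      · rw [← h01, show j = ⟨0, ht0⟩ from Fin.ext h]
      · have := hdvd' 0 j (by omega)
        simpa using this
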